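/- Let $g$ be a positive integer and let $\mathbb R\langle a,x\rangle$ be the algebra of polynomials in the $2g$ non-commuting variables $a=(a_1,\dots,a_g)$, $x=(x_1,\dots,x_g)$, with the involution ${}^T$ that reverses words and fixes each variable. Let $\mathbb S_n(\mathbb R^g)$ denote the set of $g$-tuples of real symmetric $n\times n$ matrices and $\mathbb S(\mathbb R^g)=(\mathbb S_n(\mathbb R^g))_{n}$. Let $\mathcal W=(\mathcal W_n)_n$ be a nonempty open domain in $\mathbb S(\mathbb R^g\times\mathbb R^g)$: each $\mathcal W_n$ is an open subset of $\mathbb S_n(\mathbb R^g)\times\mathbb S_n(\mathbb R^g)$, the sequence is closed under direct sums, and $\mathcal W_n\neq\emptyset$ for some $n\ge 1$. Put $\pi_a(\mathcal W)_n=\{A : (A,X)\in\mathcal W_n\text{ for some }X\}$. A polynomial $p(a,x)$ is called convex in $x$ on a sequence $\mathcal D=(\mathcal D_n)_n$ of sets $\mathcal D_n\subset\mathbb S_n(\mathbb R^g)\times\mathbb S_n(\mathbb R^g)$ if, for all $n$ and all $(A,X),(A,Y)\in\mathcal D_n$ such that $(A,tX+(1-t)Y)\in\mathcal D_n$ for every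 $0\le t\le 1$, one has $$t\,p(A,X)+(1-t)\,p(A,Y)-p(A,tX+(1-t)Y)\succeq 0\qquad(0\le t\le 1).$$ Suppose that $p=p^T\in\mathbb R\langle a,x\rangle$ is convex in $x$ on $\mathcal W$. Then $$p(a,x)=L(a,x)+V(a,x)^T Z(a)\,V(a,x),$$ where 1. $Z(a)$ is a square matrix, of some finite size, of polynomials in $a$ that is symmetric ($Z_{ij}^T=Z_{ji}$); 2. $Z(A)\succeq 0$ for every $n$ and every $A\in\pi_a(\mathcal W)_n$; 3. $V(a,x)$ is a column vector of polynomials, each linear (homogeneous of degree one) in $x$; 4. $L(a,x)$ is a symmetric polynomial of degree at most one in $x$. Moreover, $p$ is convex in $x$ on the product domain $\pi_a(\mathcal W)\times\mathbb S(\mathbb R^g)$, and $p$ has degree at most two in $x$. -/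

import Mathlib

open Matrix

/-- `𝕊_n`: the real symmetric `n × n` matrices, with the linear structure and topology
inherited from the space of all real `n × n` matrices. -/
abbrev SymMat (n : ℕ) : Type := selfAdjoint (Matrix (Fin n) (Fin n) ℝ)

/-- `𝕊_n(ℝ^g)`: the `g`-tuples of real symmetric `n × n` matrices. -/
abbrev SymTuple (g n : ℕ) : Type := Fin g → SymMat n

/-- The polynomials in the `g` free symmetric variables `a`.
The involution is `star`: it reverses words and fixes the letters and the real scalars. -/
abbrev PolyA (g : ℕ) : Type := FreeAlgebra ℝ (Fin g)

/-- `ℝ⟨a, x⟩`: the polynomials in the free symmetric variables `a_1, …, a_g`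
(letters `Sum.inl j`) and `x_1, …, x_g` (letters `Sum.inr j`). -/
abbrev PolyAX (g : ℕ) : Type := FreeAlgebra ℝ (Fin g ⊕ Fin g)

namespace NCPoly

variable {g : ℕ}

/-- A polynomial in `a` regarded as a polynomial in `(a, x)`. -/
noncomputable def inclA : PolyA g →ₐ[ℝ] PolyAX g :=
  FreeAlgebra.lift ℝ fun j => FreeAlgebra.ι ℝ (Sum.inl j)

/-- The value `q(A)` of a polynomial in `a`. -/
noncomputable def evalA {n : ℕ} (A : SymTuple g n) (q : PolyA g) : Matrix (Fin n) (Fin n) ℝ :=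
  FreeAlgebra.lift ℝ (fun j => (A j : Matrix (Fin n) (Fin n) ℝ)) q

/-- The value `p(A, X)` of a polynomial in `(a, x)`. -/
noncomputable def eval {n : ℕ} (A X : SymTuple g n) (p : PolyAX g) : Matrix (Fin n) (Fin n) ℝ :=
  FreeAlgebra.lift ℝ
    (Sum.elim (fun j => (A j : Matrix (Fin n) (Fin n) ℝ))
      (fun j => (X j : Matrix (Fin n) (Fin n) ℝ))) p

/-- The coefficient of the word `w` in `p`. -/
noncomputable def coeff (p : PolyAX g) (w : FreeMonoid (Fin g ⊕ Fin g)) : ℝ :=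
  (FreeAlgebra.equivMonoidAlgebraFreeMonoid p).coeff w

/-- The number of letters `x_1, …, x_g` in a word in `(a, x)`, counted with multiplicity. -/
def wordDegX (w : FreeMonoid (Fin g ⊕ Fin g)) : ℕ :=
  (FreeMonoid.toList w).countP Sum.isRight

/-- `p` has degree at most `d` in `x`. -/
def DegXLE (p : PolyAX g) (d : ℕ) : Prop :=
  ∀ w, coeff p w ≠ 0 → wordDegX w ≤ d

/-- `p` is linear in `x`, that is, homogeneous of degree one in `x`. -/
def LinearInX (p : PolyAX g) : Prop :=
  ∀ w, coeff p w ≠ 0 → wordDegX w = 1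

/-- `Vᵀ Z V` for a square matrix `Z` of polynomials in `a` and a column `V` of polynomials
in `(a, x)`. -/
noncomputable def quadForm {N : ℕ} (Z : Matrix (Fin N) (Fin N) (PolyA g))
    (V : Fin N → PolyAX g) : PolyAX g :=
  ∑ i, ∑ j, star (V i) * inclA (Z i j) * V j

/-- The value `Z(A)`, a real block matrix with blocks `Z_{ij}(A)`, of a matrix polynomial. -/
noncomputable def evalMatA {N n : ℕ} (Z : Matrix (Fin N) (Fin N) (PolyA g)) (A : SymTuple g n) :
    Matrix (Fin N × Fin n) (Fin N × Fin n) ℝ :=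
  Matrix.of fun r s => evalA A (Z r.1 s.1) r.2 s.2

end NCPoly

/-- The direct sum `P ⊕ Q` of two square matrices. -/
def matDirectSum {m n : ℕ} (P : Matrix (Fin m) (Fin m) ℝ) (Q : Matrix (Fin n) (Fin n) ℝ) :
    Matrix (Fin (m + n)) (Fin (m + n)) ℝ :=
  Matrix.reindex finSumFinEquiv finSumFinEquiv (Matrix.fromBlocks P 0 0 Q)

theorem matDirectSum_mem {m n : ℕ} (P : SymMat m) (Q : SymMat n) :
    matDirectSum (P : Matrix (Fin m) (Fin m) ℝ) (Q : Matrix (Fin n) (Fin n) ℝ) ∈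
      selfAdjoint (Matrix (Fin (m + n)) (Fin (m + n)) ℝ) := by
  have hP : (P : Matrix (Fin m) (Fin m) ℝ)ᴴ = P := selfAdjoint.mem_iff.1 P.2
  have hQ : (Q : Matrix (Fin n) (Fin n) ℝ)ᴴ = Q := selfAdjoint.mem_iff.1 Q.2
  rw [selfAdjoint.mem_iff, Matrix.star_eq_conjTranspose, matDirectSum,
    Matrix.conjTranspose_reindex, Matrix.fromBlocks_conjTranspose, hP, hQ]
  simp

/-- The entrywise direct sum of two tuples of symmetric matrices. -/
def SymTuple.directSum {g m n : ℕ} (A : SymTuple g m) (B : SymTuple g n) : SymTuple g (m + n) :=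
  fun j => ⟨matDirectSum (A j) (B j), matDirectSum_mem (A j) (B j)⟩

/-- A sequence of subsets of `𝕊_n(ℝ^g)`. -/
abbrev NCSet (g : ℕ) : Type := ∀ n : ℕ, Set (SymTuple g n)

/-- A sequence of subsets of `𝕊_n(ℝ^g × ℝ^g)`. -/
abbrev NCSet₂ (g : ℕ) : Type := ∀ n : ℕ, Set (SymTuple g n × SymTuple g n)

namespace NCSet₂

variable {g : ℕ}

/-- A non-commutative domain: a sequence of sets that is closed under direct sums. -/
def IsDomain (W : NCSet₂ g) : Prop :=
  ∀ (m n : ℕ) (A X : SymTuple g m) (B Y : SymTuple g n), (A, X) ∈ W m → (B, Y) ∈ W n →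
    (A.directSum B, X.directSum Y) ∈ W (m + n)

/-- Each `W_n` is open in `𝕊_n(ℝ^g × ℝ^g)`. -/
def IsOpenSeq (W : NCSet₂ g) : Prop := ∀ n, IsOpen (W n)

/-- The coordinate projection `π_a(W)`. -/
def projA (W : NCSet₂ g) : NCSet g := fun n => {A | ∃ X, (A, X) ∈ W n}

/-- The product `U × 𝒱` of two sequences of sets. -/
def prod (U 𝒱 : NCSet g) : NCSet₂ g := fun n => U n ×ˢ 𝒱 n

/-- `p` is convex in `x` on `W`. -/
def ConvexInX (W : NCSet₂ g) (p : PolyAX g) : Prop :=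
  ∀ (n : ℕ) (A X Y : SymTuple g n), (A, X) ∈ W n → (A, Y) ∈ W n →
    (∀ t : ℝ, 0 ≤ t → t ≤ 1 → (A, t • X + (1 - t) • Y) ∈ W n) →
    ∀ t : ℝ, 0 ≤ t → t ≤ 1 →
      (t • NCPoly.eval A X p + (1 - t) • NCPoly.eval A Y p
        - NCPoly.eval A (t • X + (1 - t) • Y) p).PosSemidef

end NCSet₂

/-- `𝕊(ℝ^g)`, the sequence of all of `𝕊_n(ℝ^g)`. -/
def NCSet.full (g : ℕ) : NCSet g := fun _ => Set.univ

/-!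
Half the Hessian of `p` in `x`, in the direction `h`, is a quadratic form in the border monomials
`h_j w`, where `w` runs over the words in `(a, x)`; its middle matrix has as its entry at
`(x_i u, x_j w)` the polynomial `∑ c m` over the words `m`, with `c` the coefficient of
`(x_i u)ᵀ m x_j w` in `p`. Convexity on an open set makes the Hessian positive semidefinite
(`secondVar_nonneg`), and the point is to pass from the Hessian to the middle matrix.

Closure under direct sums makes this pass immediate. The domain contains a point `(B, Y)` at
which the words up to any given length, applied to a suitable vector `v`, are linearly
independent (`exists_linearIndependent_words`): the symmetrised creation operators of the truncated
Fock space have this property, and the property is generic along a line. Given any point `(A, X)`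
of the domain, evaluate the Hessian at `(A ⊕ B, X ⊕ Y)` in an off-diagonal direction with upper right
block `K`, at the vector `(0, v)`. The border vector then has the entries `K_j w(B, Y) v`, which are
arbitrary, while the middle matrix is evaluated at `(A, X)`. Hence the middle matrix is positive
semidefinite on the whole domain (`middleMatrix_posSemidef`).

If `p` had degree `D > 2` in `x`, a word of degree `D` would give a nonzero entry of the middle
matrix in a column whose diagonal entry would need words of degree at least `2 D - 2 > D` and so
vanishes. This contradicts positivity (`degXLE_two`). Once the degree is at most two, the middle
matrix restricted to the border monomials `x_j w` with `w` a word in `a` is a polynomial `Z` in `a`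
alone, and `Vᵀ Z V` is exactly the part of `p` of degree two in `x` (`wcoeff_quadForm`). The
convexity on the product follows from the identity for the defect of `Vᵀ Z V` along a segment
(`convexInX_of_representation`).
-/

/-! ### Words and coefficients -/

namespace NCPoly

section Words

variable {α : Type*}

/-- The monomial of the free algebra given by a list of letters. -/
noncomputable def word (l : List α) : FreeAlgebra ℝ α := (l.map (FreeAlgebra.ι ℝ)).prod

@[simp] theorem word_nil : word ([] : List α) = 1 := rfl

theorem word_cons (c : α) (l : List α) : word (c :: l) = FreeAlgebra.ι ℝ c * word l := by
  simp [word]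

theorem word_append (l l' : List α) : word (l ++ l') = word l * word l' := by
  simp [word]

theorem star_word (l : List α) : star (word l) = word l.reverse := by
  induction l with
  | nil => simp
  | cons c l ih => simp [word_cons, word_append, ih]

theorem lift_word {R : Type*} [Ring R] [Algebra ℝ R] (f : α → R) (l : List α) :
    FreeAlgebra.lift ℝ f (word l) = (l.map f).prod := by
  simp [word, map_list_prod, Function.comp_def]

theorem star_smul_word (r : ℝ) (l : List α) : star (r • word l) = r • word l.reverse := by
  rw [Algebra.smul_def, star_mul, FreeAlgebra.star_algebraMap, star_word, ← Algebra.commutes,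
    Algebra.smul_def]

theorem equivMonoidAlgebra_word (l : List α) :
    FreeAlgebra.equivMonoidAlgebraFreeMonoid (word l) =
      MonoidAlgebra.single (FreeMonoid.ofList l) (1 : ℝ) := by
  induction l with
  | nil => rw [word_nil, map_one]; rfl
  | cons c l ih =>
    rw [word_cons, map_mul, ih, FreeMonoid.ofList_cons]
    simp [FreeAlgebra.equivMonoidAlgebraFreeMonoid, MonoidAlgebra.single_mul_single]

variable (α) in
/-- The words of length at most `d`. -/
noncomputable def wordsLE [Finite α] (d : ℕ) : Finset (List α) :=
  (List.finite_length_le α d).toFinset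

@[simp] theorem mem_wordsLE [Finite α] {d : ℕ} {l : List α} :
    l ∈ wordsLE α d ↔ l.length ≤ d := by
  simp [wordsLE]

theorem sum_wordsLE_reverse [Finite α] {M : Type*} [AddCommMonoid M] (d : ℕ) (f : List α → M) :
    ∑ l ∈ wordsLE α d, f l.reverse = ∑ l ∈ wordsLE α d, f l :=
  Finset.sum_nbij' List.reverse List.reverse (by simp) (by simp) (by simp) (by simp) (by simp)

end Words

variable {g : ℕ}

/-- The coefficient of a word, the word being given as a list of letters. -/
noncomputable def wcoeff (p : PolyAX g) (l : List (Fin g ⊕ Fin g)) : ℝ :=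
  coeff p (FreeMonoid.ofList l)

/-- The letters `(a, x)` sent to the matrices `(A, X)`. -/
def letters {n : ℕ} (A X : SymTuple g n) (c : Fin g ⊕ Fin g) : Matrix (Fin n) (Fin n) ℝ :=
  Sum.elim (fun j => (A j : Matrix (Fin n) (Fin n) ℝ)) (fun j => (X j : Matrix (Fin n) (Fin n) ℝ)) c

theorem wcoeff_add (p q : PolyAX g) (l) : wcoeff (p + q) l = wcoeff p l + wcoeff q l := by
  simp [wcoeff, coeff]

theorem wcoeff_sub (p q : PolyAX g) (l) : wcoeff (p - q) l = wcoeff p l - wcoeff q l := by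
  rw [eq_sub_iff_add_eq, ← wcoeff_add, sub_add_cancel]

theorem wcoeff_smul (r : ℝ) (p : PolyAX g) (l) : wcoeff (r • p) l = r * wcoeff p l := by
  simp [wcoeff, coeff]

theorem wcoeff_sum {ι : Type*} (s : Finset ι) (f : ι → PolyAX g) (l) :
    wcoeff (∑ i ∈ s, f i) l = ∑ i ∈ s, wcoeff (f i) l := by
  simp [wcoeff, coeff, map_sum, MonoidAlgebra.coeff_sum]

theorem wcoeff_word (l l' : List (Fin g ⊕ Fin g)) :
    wcoeff (word l) l' = if l = l' then 1 else 0 := by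
  classical
  rw [wcoeff, coeff, equivMonoidAlgebra_word]
  simp only [MonoidAlgebra.coeff_single, Finsupp.single_apply, EmbeddingLike.apply_eq_iff_eq]

theorem ext_wcoeff {p q : PolyAX g} (h : ∀ l, wcoeff p l = wcoeff q l) : p = q := by
  apply FreeAlgebra.equivMonoidAlgebraFreeMonoid.injective
  apply MonoidAlgebra.coeff_injective
  ext w
  exact h (FreeMonoid.toList w)

theorem exists_length_le (p : PolyAX g) : ∃ d, ∀ l, wcoeff p l ≠ 0 → l.length ≤ d := by
  let s := (FreeAlgebra.equivMonoidAlgebraFreeMonoid p).coeff.support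
  refine ⟨s.sup fun w => (FreeMonoid.toList w).length, fun l hl => ?_⟩
  exact Finset.le_sup (f := fun w => (FreeMonoid.toList w).length)
    (Finsupp.mem_support_iff.2 hl : FreeMonoid.ofList l ∈ s)

theorem eq_sum_word {p : PolyAX g} {d : ℕ} (hd : ∀ l, wcoeff p l ≠ 0 → l.length ≤ d) :
    p = ∑ l ∈ wordsLE _ d, wcoeff p l • word l := by
  refine ext_wcoeff fun l => ?_
  simp only [wcoeff_sum, wcoeff_smul, wcoeff_word, mul_ite, mul_one, mul_zero,
    Finset.sum_ite_eq', mem_wordsLE]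
  split_ifs with h
  · rfl
  · by_contra h'
    exact h (hd l h')

theorem wcoeff_star (p : PolyAX g) (l) : wcoeff (star p) l = wcoeff p l.reverse := by
  obtain ⟨d, hd⟩ := exists_length_le p
  conv_lhs => rw [eq_sum_word hd]
  conv_rhs => rw [eq_sum_word hd]
  simp only [star_sum, star_smul_word, wcoeff_sum, wcoeff_smul, wcoeff_word,
    List.reverse_eq_iff]

theorem degXLE_iff {p : PolyAX g} {d : ℕ} :
    DegXLE p d ↔ ∀ l, wcoeff p l ≠ 0 → l.countP Sum.isRight ≤ d := Iff.rfl

theorem linearInX_iff {p : PolyAX g} :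
    LinearInX p ↔ ∀ l, wcoeff p l ≠ 0 → l.countP Sum.isRight = 1 := Iff.rfl

theorem eval_word {n : ℕ} (A X : SymTuple g n) (l : List (Fin g ⊕ Fin g)) :
    eval A X (word l) = (l.map (letters A X)).prod := lift_word _ l

theorem eval_eq_sum {n : ℕ} (A X : SymTuple g n) {p : PolyAX g} {d : ℕ}
    (hd : ∀ l, wcoeff p l ≠ 0 → l.length ≤ d) :
    eval A X p = ∑ l ∈ wordsLE _ d, wcoeff p l • (l.map (letters A X)).prod := by
  conv_lhs => rw [eq_sum_word hd]
  simp_rw [← eval_word, eval, map_sum, map_smul]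

theorem transpose_coe {n : ℕ} (S : SymMat n) :
    (S : Matrix (Fin n) (Fin n) ℝ)ᵀ = (S : Matrix (Fin n) (Fin n) ℝ) := by
  have h := selfAdjoint.mem_iff.1 S.2
  rwa [star_eq_conjTranspose, conjTranspose_eq_transpose_of_trivial] at h

theorem letters_transpose {n : ℕ} (A X : SymTuple g n) (c) :
    (letters A X c)ᵀ = letters A X c := by
  cases c <;> simp [letters, transpose_coe]

theorem prod_letters_transpose {n : ℕ} (A X : SymTuple g n) (l : List (Fin g ⊕ Fin g)) :
    ((l.map (letters A X)).prod)ᵀ = (l.reverse.map (letters A X)).prod := by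
  rw [transpose_list_prod, List.map_map, ← List.map_reverse]
  simp [Function.comp_def, letters_transpose]

theorem eval_star {n : ℕ} (A X : SymTuple g n) (p : PolyAX g) :
    eval A X (star p) = (eval A X p)ᵀ := by
  obtain ⟨d, hd⟩ := exists_length_le p
  rw [eq_sum_word hd]
  simp only [star_sum, star_smul_word, eval, map_sum, map_smul, transpose_sum, transpose_smul]
  simp only [← eval.eq_1, eval_word, prod_letters_transpose]

end NCPoly

/-! ### Points of the domain with independent words -/

namespace NCPoly

/-- Symmetrised creation operators on the truncated Fock space: applied to the vacuum vector, a
word `w` gives the basis vector of `w` plus basis vectors of strictly shorter words. -/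
theorem exists_symm_matrices_triangular (α : Type*) [Finite α] [DecidableEq α] (d N : ℕ)
    (hN : (wordsLE α d).card ≤ N) :
    ∃ (T : α → Matrix (Fin N) (Fin N) ℝ) (v : Fin N → ℝ) (e : wordsLE α d → Fin N),
      (∀ c, (T c)ᵀ = T c) ∧ ∀ u w : wordsLE α d, w.1.length ≤ u.1.length →
        ((w.1.map T).prod *ᵥ v) (e u) = if u = w then 1 else 0 := by
  classical
  obtain ⟨e⟩ : Nonempty (wordsLE α d ↪ Fin N) :=
    Function.Embedding.nonempty_of_card_le (by simpa using hN)
  let R : α → Fin N → Fin N → Prop := fun c r s =>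
    ∃ w w' : wordsLE α d, w'.1 = c :: w.1 ∧ r = e w' ∧ s = e w
  let T : α → Matrix (Fin N) (Fin N) ℝ := fun c =>
    Matrix.of fun r s => if R c r s ∨ R c s r then 1 else 0
  let v : Fin N → ℝ := Pi.single (e ⟨[], by simp⟩) 1
  refine ⟨T, v, e, fun c => ?_, ?_⟩
  · ext r s
    exact if_congr or_comm rfl rfl
  rintro u ⟨w, hw⟩
  induction w generalizing u with
  | nil =>
    intro _
    simp [v, Matrix.one_apply]
  | cons c w ih =>
    intro hlen
    have hw' : w ∈ wordsLE α d := by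
      rw [mem_wordsLE] at hw ⊢
      simp only [List.length_cons] at hw
      omega
    simp only [List.length_cons] at hlen
    rw [List.map_cons, List.prod_cons, ← mulVec_mulVec]
    set y := (w.map T).prod *ᵥ v with hy
    have key : ∀ u : wordsLE α d, w.length ≤ u.1.length →
        y (e u) = if u = ⟨w, hw'⟩ then 1 else 0 := fun u hu => ih u hw' hu
    -- annihilation from a longer word contributes nothing at `u`
    have hlow : ∀ s, R c s (e u) → y s = 0 := by
      rintro s ⟨w₁, w₂, h12, rfl, h1⟩
      have h1' : u = w₁ := e.injective h1
      have hl : w₂.1.length = u.1.length + 1 := by rw [h12, h1']; simp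
      rw [key w₂ (by omega), if_neg]
      rintro rfl
      simp only at hl
      omega
    simp only [mulVec, dotProduct]
    by_cases hu : ∃ w₁ : wordsLE α d, u.1 = c :: w₁.1
    · obtain ⟨w₁, hw₁⟩ := hu
      rw [Finset.sum_eq_single (e w₁)]
      · have h1 : T c (e u) (e w₁) = 1 := by
          simp only [T, of_apply]
          exact if_pos (Or.inl ⟨w₁, u, hw₁, rfl, rfl⟩)
        have hl : u.1.length = w₁.1.length + 1 := by rw [hw₁]; simp
        rw [h1, one_mul, key w₁ (by omega)]
        refine if_congr ?_ rfl rfl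
        rw [Subtype.ext_iff, Subtype.ext_iff, hw₁]
        simp
      · intro s _ hs
        by_cases h : R c s (e u)
        · rw [hlow s h, mul_zero]
        · have h1 : ¬ R c (e u) s := by
            rintro ⟨w₂, w₃, h23, h3, rfl⟩
            apply hs
            have h3' : u = w₃ := e.injective h3
            rw [h3'.symm, hw₁] at h23
            rw [Subtype.ext (List.cons.inj h23).2]
          simp [T, h, h1]
      · simp
    · rw [if_neg, Finset.sum_eq_zero]
      · intro s _
        by_cases h : R c s (e u)
        · rw [hlow s h, mul_zero]
        · have h1 : ¬ R c (e u) s := by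
            rintro ⟨w₂, w₃, h23, h3, rfl⟩
            have h3' : u = w₃ := e.injective h3
            exact hu ⟨w₂, by rw [h3', h23]⟩
          simp [T, h, h1]
      · rintro rfl
        exact hu ⟨⟨w, hw'⟩, rfl⟩

/-- A matrix that is unitriangular for the order by length has determinant one; nothing is assumed
about the entries `G w u` with `u` shorter than `w`. -/
theorem det_triangular_by_length {α : Type*} [Finite α] [DecidableEq α] {d : ℕ}
    (G : Matrix (wordsLE α d) (wordsLE α d) ℝ)
    (hG : ∀ u w : wordsLE α d, w.1.length ≤ u.1.length → G w u = if u = w then 1 else 0) :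
    G.det = 1 := by
  have hT : G.BlockTriangular fun w => OrderDual.toDual w.1.length := by
    intro w u h
    have h' : w.1.length < u.1.length := h
    rw [hG u w h'.le, if_neg]
    rintro rfl
    exact lt_irrefl _ h'
  rw [hT.det]
  refine Finset.prod_eq_one fun k _ => ?_
  rw [← Matrix.det_one (n := {w : wordsLE α d // OrderDual.toDual w.1.length = k}) (R := ℝ)]
  congr 1
  ext ⟨w, hw⟩ ⟨u, hu⟩
  have hwu : w.1.length = u.1.length := OrderDual.toDual.injective (hw.trans hu.symm)
  simp [toSquareBlock_def, Matrix.one_apply, hG u w hwu.le, eq_comm]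

variable {g : ℕ}

theorem continuous_line {n : ℕ} (X H : SymTuple g n) : Continuous fun t : ℝ => X + t • H := by
  refine continuous_pi fun j => Continuous.subtype_mk (f := fun t : ℝ =>
    (X j : Matrix (Fin n) (Fin n) ℝ) + t • (H j : Matrix (Fin n) (Fin n) ℝ)) ?_ _
  fun_prop

theorem nonempty_mul {W : NCSet₂ g} (hdom : W.IsDomain) {n : ℕ} (h : (W n).Nonempty) (k : ℕ) :
    (W ((k + 1) * n)).Nonempty := by
  induction k with
  | zero => rwa [zero_add, one_mul]
  | succ k ih =>
    rw [add_mul, one_mul]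
    obtain ⟨⟨A, X⟩, hA⟩ := ih
    obtain ⟨⟨B, Y⟩, hB⟩ := h
    exact ⟨_, hdom _ _ A X B Y hA hB⟩

/-- The line through two tuples, as a family of matrices over `ℝ[t]`: the words in it have
polynomial entries. -/
theorem exists_polynomial_line {N : ℕ} (A X A' X' : SymTuple g N) (v : Fin N → ℝ)
    (w : List (Fin g ⊕ Fin g)) (i : Fin N) :
    ∃ q : Polynomial ℝ, ∀ t : ℝ, q.eval t =
      ((w.map (letters (A + t • (A' - A)) (X + t • (X' - X)))).prod *ᵥ v) i := by
  induction w generalizing i with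
  | nil => exact ⟨Polynomial.C (v i), by simp⟩
  | cons c w ih =>
    choose q hq using ih
    refine ⟨∑ j, (Polynomial.C (letters A X c i j) +
      Polynomial.X * Polynomial.C (letters A' X' c i j - letters A X c i j)) * q j, fun t => ?_⟩
    rw [List.map_cons, List.prod_cons, ← mulVec_mulVec, mulVec, dotProduct,
      Polynomial.eval_finsetSum]
    refine Finset.sum_congr rfl fun j _ => ?_
    rw [Polynomial.eval_mul, hq]
    congr 1
    cases c <;> simp [letters]

/-- Since the domain is open and has points of arbitrarily large size, it contains a point at which
the words of length at most `d` applied to a suitable vector are linearly independent: this holds at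
some point of the ambient space by the Fock space construction, and along the line joining it to
a point of the domain it fails only at the zeros of a nonzero polynomial. -/
theorem exists_linearIndependent_words {W : NCSet₂ g} (hdom : W.IsDomain) (hopen : W.IsOpenSeq)
    (hne : ∃ n : ℕ, 0 < n ∧ (W n).Nonempty) (d : ℕ) :
    ∃ (N : ℕ) (B Y : SymTuple g N) (v : Fin N → ℝ), (B, Y) ∈ W N ∧
      LinearIndependent ℝ fun w : wordsLE (Fin g ⊕ Fin g) d =>
        (w.1.map (letters B Y)).prod *ᵥ v := by
  classical
  obtain ⟨n, hn, hW⟩ := hne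
  set N := ((wordsLE (Fin g ⊕ Fin g) d).card + 1) * n with hNdef
  have hN : (wordsLE (Fin g ⊕ Fin g) d).card ≤ N := by rw [hNdef]; nlinarith
  obtain ⟨⟨A, X⟩, hAX⟩ := nonempty_mul hdom hW (wordsLE (Fin g ⊕ Fin g) d).card
  obtain ⟨T, v, e, hT, hTw⟩ := exists_symm_matrices_triangular (Fin g ⊕ Fin g) d N hN
  have hsa : ∀ c, T c ∈ selfAdjoint (Matrix (Fin N) (Fin N) ℝ) := fun c => by
    rw [selfAdjoint.mem_iff, star_eq_conjTranspose, conjTranspose_eq_transpose_of_trivial, hT]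
  let A' : SymTuple g N := fun j => ⟨T (Sum.inl j), hsa _⟩
  let X' : SymTuple g N := fun j => ⟨T (Sum.inr j), hsa _⟩
  have hlet : letters A' X' = T := by
    ext1 c
    cases c <;> rfl
  choose q hq using exists_polynomial_line A X A' X' v
  let G : Matrix (wordsLE (Fin g ⊕ Fin g) d) (wordsLE (Fin g ⊕ Fin g) d) (Polynomial ℝ) :=
    Matrix.of fun w u => q w.1 (e u)
  have hGt : ∀ t : ℝ, G.det.eval t = (Matrix.of fun w u : wordsLE (Fin g ⊕ Fin g) d =>
      ((w.1.map (letters (A + t • (A' - A)) (X + t • (X' - X)))).prod *ᵥ v) (e u)).det := by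
    intro t
    rw [← Polynomial.coe_evalRingHom, RingHom.map_det]
    congr 1
    ext w u
    simp [G, hq]
  have hdet : G.det ≠ 0 := by
    intro h0
    have h1 := hGt 1
    rw [h0, det_triangular_by_length] at h1
    · simp at h1
    · intro u w h
      rw [of_apply, one_smul, one_smul, add_sub_cancel, add_sub_cancel, hlet]
      exact hTw u w h
  have hcont : Continuous fun t : ℝ => ((A + t • (A' - A), X + t • (X' - X)) :
      SymTuple g N × SymTuple g N) := by
    exact (continuous_line _ _).prodMk (continuous_line _ _)
  have hnear : ∀ᶠ t in nhdsWithin (0 : ℝ) {0}ᶜ,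
      (A + t • (A' - A), X + t • (X' - X)) ∈ W N := by
    apply nhdsWithin_le_nhds
    apply hcont.continuousAt.eventually_mem
    exact (hopen N).mem_nhds (by simpa using hAX)
  have hroot : ∀ᶠ t in nhdsWithin (0 : ℝ) {0}ᶜ, G.det.eval t ≠ 0 := by
    have hfin : {t : ℝ | G.det.eval t = 0}.Finite := by
      refine (G.det.roots.toFinset.finite_toSet).subset fun t ht => ?_
      simpa [hdet] using ht
    have := (hfin.subset (Set.sdiff_subset (t := {0}))).isClosed.isOpen_compl.mem_nhds
      (show (0 : ℝ) ∈ ({t : ℝ | G.det.eval t = 0} \ {0})ᶜ by simp)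
    filter_upwards [nhdsWithin_le_nhds this, self_mem_nhdsWithin] with t h1 h2 h3
    exact h1 ⟨h3, h2⟩
  obtain ⟨t, ht1, ht2⟩ := (hnear.and hroot).exists
  refine ⟨N, _, _, v, ht1, ?_⟩
  rw [hGt] at ht2
  exact LinearIndependent.of_comp (LinearMap.funLeft ℝ ℝ e)
    (Matrix.linearIndependent_rows_of_det_ne_zero ht2)

end NCPoly

/-! ### The second variation -/

namespace NCPoly

section Variations

variable {α R : Type*} [Ring R]

/-- The coefficient of `s` in the product of the `P c + s Q c` over the letters `c` of a word. -/
def firstVar (P Q : α → R) : List α → R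
  | [] => 0
  | c :: l => Q c * (l.map P).prod + P c * firstVar P Q l

/-- The coefficient of `s ^ 2` in the product of the `P c + s Q c` over the letters `c` of a
word. -/
def secondVar (P Q : α → R) : List α → R
  | [] => 0
  | c :: l => Q c * firstVar P Q l + P c * secondVar P Q l

theorem exists_expansion [Algebra ℝ R] [TopologicalSpace R] [IsTopologicalRing R]
    [ContinuousSMul ℝ R] (P Q : α → R) (l : List α) :
    ∃ r : ℝ → R, Continuous r ∧ ∀ s : ℝ, (l.map fun c => P c + s • Q c).prod =
      (l.map P).prod + s • firstVar P Q l + s ^ 2 • secondVar P Q l + s ^ 3 • r s := by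
  induction l with
  | nil => exact ⟨0, continuous_zero, by simp [firstVar, secondVar]⟩
  | cons c l ih =>
    obtain ⟨r, hr, h⟩ := ih
    refine ⟨fun s => P c * r s + Q c * secondVar P Q l + s • (Q c * r s), by fun_prop, fun s => ?_⟩
    rw [List.map_cons, List.prod_cons, h]
    simp only [List.map_cons, List.prod_cons, firstVar, secondVar, add_mul, mul_add,
      smul_mul_assoc, mul_smul_comm]
    module

/-- All ways of writing a word as `u c w` with a letter `c`. -/
def splits : List α → List (List α × α × List α)
  | [] => []
  | c :: l => ([], c, l) :: (splits l).map fun t => (c :: t.1, t.2)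

theorem mem_splits {l : List α} {t : List α × α × List α} :
    t ∈ splits l ↔ t.1 ++ t.2.1 :: t.2.2 = l := by
  obtain ⟨u, c, w⟩ := t
  induction l generalizing u with
  | nil => simp [splits]
  | cons b l ih =>
    cases u with
    | nil => simp [splits]
    | cons b' u => simpa [splits, and_comm, eq_comm] using fun _ => ih u

theorem nodup_splits (l : List α) : (splits l).Nodup := by
  induction l with
  | nil => simp [splits]
  | cons c l ih =>
    refine List.nodup_cons.2 ⟨by simp, ih.map ?_⟩
    rintro ⟨u, t⟩ ⟨u', t'⟩ h
    simpa using h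

/-- Double counting: summing over the words `l` and their splittings is summing over the triples
`(u, c, w)`, with `l = u c w`. -/
theorem sum_wordsLE_splits [Fintype α] [DecidableEq α] {d : ℕ} (f : List α → ℝ)
    (hf : ∀ l, f l ≠ 0 → l.length ≤ d) (F : List α × α × List α → ℝ) :
    ∑ l ∈ wordsLE α d, f l * ((splits l).map F).sum =
      ∑ u ∈ wordsLE α d, ∑ c, ∑ w ∈ wordsLE α d, f (u ++ c :: w) * F (u, c, w) := by
  have h1 : ∀ l ∈ wordsLE α d, f l * ((splits l).map F).sum =
      ∑ t ∈ wordsLE α d ×ˢ Finset.univ ×ˢ wordsLE α d,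
        if t.1 ++ t.2.1 :: t.2.2 = l then f l * F t else 0 := by
    intro l hl
    rw [← List.sum_toFinset F (nodup_splits l), Finset.mul_sum, ← Finset.sum_filter]
    refine Finset.sum_congr ?_ fun _ _ => rfl
    ext ⟨u, c, w⟩
    simp only [List.mem_toFinset, mem_splits, Finset.mem_filter, Finset.mem_product, mem_wordsLE,
      Finset.mem_univ, true_and, iff_and_self]
    rintro rfl
    simp only [mem_wordsLE, List.length_append, List.length_cons] at hl
    omega
  rw [Finset.sum_congr rfl h1, Finset.sum_comm, Finset.sum_product]
  refine Finset.sum_congr rfl fun u _ => ?_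
  rw [Finset.sum_product]
  refine Finset.sum_congr rfl fun c _ => Finset.sum_congr rfl fun w _ => ?_
  rw [Finset.sum_ite_eq]
  split_ifs with h
  · rfl
  · rw [show f (u ++ c :: w) = 0 from by_contra fun h' => h (by simpa using hf _ h'), zero_mul]

end Variations

variable {g : ℕ}

theorem letters_add_smul {n : ℕ} (A X H : SymTuple g n) (s : ℝ) :
    letters A (X + s • H) = fun c => letters A X c + s • letters 0 H c := by
  ext1 c
  cases c <;> simp [letters]

/-- If `a + b s + c s ^ 2 + O(s ^ 3)` is midpoint convex about `0`, then `0 ≤ c`. -/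
theorem nonneg_of_midpoint_convex {f r : ℝ → ℝ} (hr : Continuous r) {a b c ε : ℝ} (hε : 0 < ε)
    (hf : ∀ s, f s = a + s * b + s ^ 2 * c + s ^ 3 * r s)
    (h : ∀ s, |s| < ε → 0 ≤ f s + f (-s) - 2 * f 0) : 0 ≤ c := by
  have hlim : Filter.Tendsto (fun s => 2 * c + s * (r s - r (-s))) (nhdsWithin 0 (Set.Ioi 0))
      (nhds (2 * c)) := by
    have hc : Continuous fun s => 2 * c + s * (r s - r (-s)) := by fun_prop
    have := hc.tendsto 0
    simp only [zero_mul, add_zero] at this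
    exact this.mono_left nhdsWithin_le_nhds
  have hev : ∀ᶠ s in nhdsWithin (0 : ℝ) (Set.Ioi 0), 0 ≤ 2 * c + s * (r s - r (-s)) := by
    filter_upwards [Ioo_mem_nhdsGT hε] with s hs
    have h1 := h s (by rw [abs_of_pos hs.1]; exact hs.2)
    rw [hf, hf, hf] at h1
    have h2 : 0 ≤ s ^ 2 * (2 * c + s * (r s - r (-s))) := by linarith
    exact nonneg_of_mul_nonneg_right h2 (by have := hs.1; positivity)
  have := ge_of_tendsto hlim hev
  linarith

/-- Convexity makes the second variation of `p` in `x` positive semidefinite on the open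
set. -/
theorem secondVar_nonneg {W : NCSet₂ g} (hopen : W.IsOpenSeq) {p : PolyAX g}
    (hconv : W.ConvexInX p) {d : ℕ} (hd : ∀ l, wcoeff p l ≠ 0 → l.length ≤ d) {n : ℕ}
    {A X : SymTuple g n} (hAX : (A, X) ∈ W n) (H : SymTuple g n) (v : Fin n → ℝ) :
    0 ≤ ∑ l ∈ wordsLE _ d,
      wcoeff p l * (v ⬝ᵥ secondVar (letters A X) (letters 0 H) l *ᵥ v) := by
  choose r hr hexp using exists_expansion (letters A X) (letters 0 H)
  obtain ⟨ε, hε, hball⟩ : ∃ ε > 0, ∀ s : ℝ, |s| < ε → (A, X + s • H) ∈ W n := by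
    have hc : Continuous fun s : ℝ => ((A, X + s • H) : SymTuple g n × SymTuple g n) :=
      continuous_const.prodMk (continuous_line _ _)
    obtain ⟨ε, hε, h⟩ := Metric.isOpen_iff.1 ((hopen n).preimage hc) 0 (by simpa using hAX)
    exact ⟨ε, hε, fun s hs => h (by simpa using hs)⟩
  refine nonneg_of_midpoint_convex (f := fun s => v ⬝ᵥ eval A (X + s • H) p *ᵥ v)
    (r := fun s => ∑ l ∈ wordsLE _ d, wcoeff p l * (v ⬝ᵥ r l s *ᵥ v))
    (a := ∑ l ∈ wordsLE _ d, wcoeff p l * (v ⬝ᵥ (l.map (letters A X)).prod *ᵥ v))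
    (b := ∑ l ∈ wordsLE _ d,
      wcoeff p l * (v ⬝ᵥ firstVar (letters A X) (letters 0 H) l *ᵥ v)) ?_ hε ?_ ?_
  · simp only [dotProduct, mulVec]
    have hr' : ∀ l i j, Continuous fun s => r l s i j := fun l i j =>
      (continuous_apply j).comp ((continuous_apply i).comp (hr l))
    fun_prop
  · intro s
    simp only [eval_eq_sum A _ hd, letters_add_smul, hexp, sum_mulVec, dotProduct_sum,
      Finset.mul_sum, ← Finset.sum_add_distrib, smul_mulVec, add_mulVec, dotProduct_smul,
      dotProduct_add, smul_eq_mul]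
    refine Finset.sum_congr rfl fun l _ => ?_
    ring
  · intro s hs
    have h := hconv n A (X + s • H) (X + (-s) • H) (hball s hs) (hball (-s) (by rwa [abs_neg]))
      (fun t ht0 ht1 => by
        have : t • (X + s • H) + (1 - t) • (X + -s • H) = X + ((2 * t - 1) * s) • H := by module
        rw [this]
        apply hball
        rw [abs_mul]
        have : |2 * t - 1| ≤ 1 := by rw [abs_le]; constructor <;> linarith
        nlinarith [abs_nonneg s]) (1 / 2) (by norm_num) (by norm_num)
    have hmid : (1 / 2 : ℝ) • (X + s • H) + (1 - 1 / 2 : ℝ) • (X + -s • H) =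
        X + (0 : ℝ) • H := by module
    rw [hmid] at h
    have h' := h.dotProduct_mulVec_nonneg v
    simp only [star_trivial, sub_mulVec, add_mulVec, smul_mulVec, dotProduct_sub, dotProduct_add,
      dotProduct_smul, smul_eq_mul] at h'
    linarith

end NCPoly

/-! ### The middle matrix -/

namespace NCPoly

variable {g : ℕ}

section Blocks

variable {n m : ℕ}

/-- A vector of `ℝ^(n + m)` with its two components. -/
def blockVec (x : Fin n → ℝ) (y : Fin m → ℝ) : Fin (n + m) → ℝ :=
  Sum.elim x y ∘ finSumFinEquiv.symm

theorem blockVec_add (x x' : Fin n → ℝ) (y y' : Fin m → ℝ) :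
    blockVec x y + blockVec x' y' = blockVec (x + x') (y + y') := by
  ext k
  obtain ⟨k, rfl⟩ := finSumFinEquiv.surjective k
  cases k <;> simp [blockVec]

theorem blockVec_dotProduct (x x' : Fin n → ℝ) (y y' : Fin m → ℝ) :
    blockVec x y ⬝ᵥ blockVec x' y' = x ⬝ᵥ x' + y ⬝ᵥ y' := by
  simp [blockVec, dotProduct, ← finSumFinEquiv.sum_comp, Fintype.sum_sum_type]

theorem reindex_fromBlocks_mulVec (P : Matrix (Fin n) (Fin n) ℝ) (Q : Matrix (Fin n) (Fin m) ℝ)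
    (R : Matrix (Fin m) (Fin n) ℝ) (S : Matrix (Fin m) (Fin m) ℝ) (x : Fin n → ℝ)
    (y : Fin m → ℝ) :
    reindex finSumFinEquiv finSumFinEquiv (fromBlocks P Q R S) *ᵥ blockVec x y =
      blockVec (P *ᵥ x + Q *ᵥ y) (R *ᵥ x + S *ᵥ y) := by
  rw [blockVec, reindex_apply, submatrix_mulVec_equiv, blockVec]
  simp [Function.comp_assoc, fromBlocks_mulVec]

/-- The tuple of symmetric matrices with off-diagonal blocks `K j` and `(K j)ᵀ`. -/
def offDiag (K : Fin g → Matrix (Fin n) (Fin m) ℝ) : SymTuple g (n + m) := fun j =>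
  ⟨reindex finSumFinEquiv finSumFinEquiv (fromBlocks 0 (K j) (K j)ᵀ 0), by
    rw [selfAdjoint.mem_iff, star_eq_conjTranspose, conjTranspose_reindex,
      fromBlocks_conjTranspose]
    simp [conjTranspose_eq_transpose_of_trivial]⟩

theorem letters_directSum_mulVec (A X : SymTuple g n) (B Y : SymTuple g m) (c) (x : Fin n → ℝ)
    (y : Fin m → ℝ) :
    letters (A.directSum B) (X.directSum Y) c *ᵥ blockVec x y =
      blockVec (letters A X c *ᵥ x) (letters B Y c *ᵥ y) := by
  cases c <;>
    simp only [letters, Sum.elim_inl, Sum.elim_inr, SymTuple.directSum, matDirectSum,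
      reindex_fromBlocks_mulVec, zero_mulVec, add_zero, zero_add]

theorem letters_offDiag_mulVec (K : Fin g → Matrix (Fin n) (Fin m) ℝ) (c) (x : Fin n → ℝ)
    (y : Fin m → ℝ) :
    letters 0 (offDiag K) c *ᵥ blockVec x y =
      blockVec (Sum.elim (fun _ => 0) K c *ᵥ y) ((Sum.elim (fun _ => 0) K c)ᵀ *ᵥ x) := by
  cases c
  · ext k
    obtain ⟨k, rfl⟩ := finSumFinEquiv.surjective k
    cases k <;> simp [letters, blockVec]
  · simp only [letters, Sum.elim_inr, offDiag, reindex_fromBlocks_mulVec, zero_mulVec, add_zero,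
      zero_add]

theorem prod_letters_directSum_mulVec (A X : SymTuple g n) (B Y : SymTuple g m)
    (l : List (Fin g ⊕ Fin g))
    (x : Fin n → ℝ) (y : Fin m → ℝ) :
    (l.map (letters (A.directSum B) (X.directSum Y))).prod *ᵥ blockVec x y =
      blockVec ((l.map (letters A X)).prod *ᵥ x) ((l.map (letters B Y)).prod *ᵥ y) := by
  induction l with
  | nil => simp
  | cons c l ih =>
    simp only [List.map_cons, List.prod_cons, ← mulVec_mulVec, ih, letters_directSum_mulVec]

variable (A X : SymTuple g n) (B Y : SymTuple g m) (K : Fin g → Matrix (Fin n) (Fin m) ℝ)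

theorem firstVar_mulVec (l : List (Fin g ⊕ Fin g)) (y : Fin m → ℝ) :
    firstVar (letters (A.directSum B) (X.directSum Y)) (letters 0 (offDiag K)) l *ᵥ
        blockVec 0 y =
      blockVec ((splits l).map fun t => (t.1.map (letters A X)).prod *ᵥ
        Sum.elim (fun _ => 0) K t.2.1 *ᵥ (t.2.2.map (letters B Y)).prod *ᵥ y).sum 0 := by
  induction l with
  | nil =>
    ext k
    obtain ⟨k, rfl⟩ := finSumFinEquiv.surjective k
    cases k <;> simp [firstVar, splits, blockVec]
  | cons c l ih =>
    rw [firstVar, add_mulVec, ← mulVec_mulVec, ← mulVec_mulVec, ih,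
      prod_letters_directSum_mulVec, letters_offDiag_mulVec, letters_directSum_mulVec,
      blockVec_add]
    simp only [mulVec_zero, add_zero, splits, List.map_cons, List.sum_cons, List.map_nil,
      List.prod_nil, one_mulVec, List.map_map, Function.comp_def, List.prod_cons, ← mulVec_mulVec]
    congr 2
    rw [← mulVecLin_apply, map_list_sum, List.map_map]
    rfl

/-- The lower right block of the second variation at a direct sum, in an off-diagonal direction:
the letter of the first factor `K` is preceded by a word in `(B, Y)`, and between the two factors
stands a word in `(A, X)`. -/
theorem dotProduct_secondVar_mulVec (l : List (Fin g ⊕ Fin g)) (x y : Fin m → ℝ) :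
    blockVec 0 x ⬝ᵥ
        secondVar (letters (A.directSum B) (X.directSum Y)) (letters 0 (offDiag K)) l *ᵥ
          blockVec 0 y =
      ((splits l).map fun t =>
        (Sum.elim (fun _ => 0) K t.2.1 *ᵥ (t.1.reverse.map (letters B Y)).prod *ᵥ x) ⬝ᵥ
          ((splits t.2.2).map fun t' => (t'.1.map (letters A X)).prod *ᵥ
            Sum.elim (fun _ => 0) K t'.2.1 *ᵥ (t'.2.2.map (letters B Y)).prod *ᵥ y).sum).sum := by
  induction l generalizing x with
  | nil => simp [secondVar, splits]
  | cons c l ih =>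
    have hswap : ∀ (A X : SymTuple g (n + m)) (c) (u w : Fin (n + m) → ℝ),
        u ⬝ᵥ letters A X c *ᵥ w = (letters A X c *ᵥ u) ⬝ᵥ w := by
      intro A X c u w
      rw [dotProduct_mulVec, ← mulVec_transpose, letters_transpose]
    rw [secondVar, add_mulVec, dotProduct_add, ← mulVec_mulVec, ← mulVec_mulVec, hswap, hswap,
      letters_offDiag_mulVec, letters_directSum_mulVec, firstVar_mulVec, blockVec_dotProduct,
      mulVec_zero, mulVec_zero, ih]
    simp [splits, Function.comp_def, ← mulVec_mulVec]

end Blocks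

/-- The value at `(A, X)` of the `(r, s)` entry of the middle matrix of half the Hessian of `p` in `x`.
Its rows and columns are indexed by the border monomials `x_i u`, encoded as the pair `(i, u)`, and
the entry is the sum of `c m` over the words `m`, where `c` is the coefficient of
`(x_i u)ᵀ m x_j w` in `p`. -/
noncomputable def middleBlock {n : ℕ} (p : PolyAX g) (d : ℕ) (A X : SymTuple g n)
    (r s : Fin g × List (Fin g ⊕ Fin g)) : Matrix (Fin n) (Fin n) ℝ :=
  ∑ m ∈ wordsLE _ d, wcoeff p (r.2.reverse ++ Sum.inr r.1 :: (m ++ Sum.inr s.1 :: s.2)) •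
    (m.map (letters A X)).prod

/-- The middle matrix of half the Hessian of `p` in `x`, at `(A, X)`, restricted to the border
monomials `x_i u` with `u` of length at most `d`. -/
noncomputable def middleMatrix {n : ℕ} (p : PolyAX g) (d : ℕ) (A X : SymTuple g n) :
    Matrix ((Fin g × wordsLE (Fin g ⊕ Fin g) d) × Fin n)
      ((Fin g × wordsLE (Fin g ⊕ Fin g) d) × Fin n) ℝ :=
  Matrix.of fun r s => middleBlock p d A X (r.1.1, r.1.2) (s.1.1, s.1.2) r.2 s.2

theorem dotProduct_middleMatrix_mulVec {n : ℕ} (p : PolyAX g) (d : ℕ) (A X : SymTuple g n)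
    (x : (Fin g × wordsLE (Fin g ⊕ Fin g) d) × Fin n → ℝ) :
    x ⬝ᵥ middleMatrix p d A X *ᵥ x = ∑ r, ∑ s, (fun k => x (r, k)) ⬝ᵥ
      middleBlock p d A X (r.1, r.2.1) (s.1, s.2.1) *ᵥ fun k => x (s, k) := by
  simp only [dotProduct, mulVec, middleMatrix, of_apply]
  rw [Fintype.sum_prod_type]
  refine Finset.sum_congr rfl fun r _ => ?_
  rw [Finset.sum_comm]
  refine Finset.sum_congr rfl fun k _ => ?_
  rw [Fintype.sum_prod_type, Finset.mul_sum]

theorem middleBlock_transpose {n : ℕ} {p : PolyAX g} (hp : star p = p) (d : ℕ)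
    (A X : SymTuple g n) (r s) : (middleBlock p d A X r s)ᵀ = middleBlock p d A X s r := by
  simp only [middleBlock, transpose_sum, transpose_smul, prod_letters_transpose]
  rw [← sum_wordsLE_reverse]
  refine Finset.sum_congr rfl fun m _ => ?_
  rw [List.reverse_reverse]
  congr 1
  conv_lhs => rw [← hp, wcoeff_star]
  simp

theorem _root_.LinearIndependent.exists_matrix_mulVec_eq {ι : Type*} {n m : ℕ}
    {v : ι → Fin m → ℝ} (hv : LinearIndependent ℝ v) (z : ι → Fin n → ℝ) :
    ∃ K : Matrix (Fin n) (Fin m) ℝ, ∀ i, K *ᵥ v i = z i := by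
  obtain ⟨f, hf⟩ := LinearMap.exists_leftInverse_of_injective _
    (LinearMap.ker_eq_bot.2 hv)
  refine ⟨LinearMap.toMatrix' (Finsupp.linearCombination ℝ z ∘ₗ f), fun i => ?_⟩
  have h := LinearMap.congr_fun hf (Finsupp.single i 1)
  simp only [LinearMap.comp_apply, Finsupp.linearCombination_single, one_smul,
    LinearMap.id_apply] at h
  rw [LinearMap.toMatrix'_mulVec, LinearMap.comp_apply, h, Finsupp.linearCombination_single,
    one_smul]

/-- The middle matrix is positive semidefinite at every point `(A, X)` of the domain. For a point
`(B, Y)` at which the words applied to `v` are independent, the second variation at the direct sum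
`(A ⊕ B, X ⊕ Y)`, in an off-diagonal direction `K` and at the vector `(0, v)`, is the quadratic form
of the middle matrix at the vector with components `K_j w(B, Y) v`, and these are arbitrary. -/
theorem middleMatrix_posSemidef {W : NCSet₂ g} (hdom : W.IsDomain) (hopen : W.IsOpenSeq)
    (hne : ∃ n : ℕ, 0 < n ∧ (W n).Nonempty) {p : PolyAX g} (hp : star p = p)
    (hconv : W.ConvexInX p) {d : ℕ} (hd : ∀ l, wcoeff p l ≠ 0 → l.length ≤ d) {n : ℕ}
    {A X : SymTuple g n} (hAX : (A, X) ∈ W n) : (middleMatrix p d A X).PosSemidef := by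
  refine .of_dotProduct_mulVec_nonneg ?_ fun x => ?_
  · ext r s
    simp only [middleMatrix, conjTranspose_apply, of_apply, star_trivial]
    rw [← middleBlock_transpose hp, transpose_apply]
  obtain ⟨m, B, Y, v, hBY, hli⟩ := exists_linearIndependent_words hdom hopen hne d
  choose K hK using fun j : Fin g => hli.exists_matrix_mulVec_eq
    fun (w : wordsLE (Fin g ⊕ Fin g) d) (k : Fin n) => x ((j, w), k)
  have h := secondVar_nonneg hopen hconv hd (hdom n m A X B Y hAX hBY) (offDiag K) (blockVec 0 v)
  simp only [dotProduct_secondVar_mulVec] at h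
  rw [sum_wordsLE_splits (wcoeff p) hd (fun t =>
        (Sum.elim (fun _ => 0) K t.2.1 *ᵥ (t.1.reverse.map (letters B Y)).prod *ᵥ v) ⬝ᵥ
          ((splits t.2.2).map fun t' => (t'.1.map (letters A X)).prod *ᵥ
            Sum.elim (fun _ => 0) K t'.2.1 *ᵥ (t'.2.2.map (letters B Y)).prod *ᵥ v).sum)] at h
  have hpush : ∀ (y : Fin n → ℝ) (L : List (List (Fin g ⊕ Fin g) × (Fin g ⊕ Fin g) ×
      List (Fin g ⊕ Fin g))) (f), y ⬝ᵥ (L.map f).sum = (L.map fun t => y ⬝ᵥ f t).sum := by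
    intro y L f
    induction L with
    | nil => simp
    | cons t L ih => simp [dotProduct_add, ih]
  simp only [hpush] at h
  have hinner : ∀ (u : List (Fin g ⊕ Fin g)) (c : Fin g ⊕ Fin g)
      (F : List (Fin g ⊕ Fin g) × (Fin g ⊕ Fin g) × List (Fin g ⊕ Fin g) → ℝ),
      ∑ w ∈ wordsLE _ d, wcoeff p (u ++ c :: w) * ((splits w).map F).sum =
        ∑ m ∈ wordsLE _ d, ∑ c', ∑ w ∈ wordsLE _ d,
          wcoeff p (u ++ c :: (m ++ c' :: w)) * F (m, c', w) := by
    intro u c F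
    refine sum_wordsLE_splits (fun w => wcoeff p (u ++ c :: w)) (fun l hl => ?_) F
    have := hd _ hl
    simp only [List.length_append, List.length_cons] at this
    omega
  simp only [hinner] at h
  rw [← sum_wordsLE_reverse] at h
  simp only [List.reverse_reverse, Fintype.sum_sum_type, Sum.elim_inl, Sum.elim_inr, zero_mulVec,
    mulVec_zero, zero_dotProduct, dotProduct_zero, mul_zero, Finset.sum_const_zero, zero_add] at h
  have hx : ∀ r : Fin g × wordsLE (Fin g ⊕ Fin g) d, (fun k => x (r, k)) =
      K r.1 *ᵥ (r.2.1.map (letters B Y)).prod *ᵥ v := fun r => (hK r.1 r.2).symm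
  rw [star_trivial, dotProduct_middleMatrix_mulVec]
  simp only [hx, Fintype.sum_prod_type]
  refine h.trans_eq ?_
  rw [Finset.sum_comm]
  refine Finset.sum_congr rfl fun i _ => ?_
  rw [← Finset.sum_coe_sort]
  refine Finset.sum_congr rfl fun u _ => ?_
  rw [Finset.sum_comm]
  refine Finset.sum_congr rfl fun j _ => ?_
  rw [Finset.sum_comm, ← Finset.sum_coe_sort]
  refine Finset.sum_congr rfl fun w _ => ?_
  simp only [middleBlock, sum_mulVec, smul_mulVec, dotProduct_sum, dotProduct_smul, smul_eq_mul]

end NCPoly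

/-! ### The degree bound -/

namespace NCPoly

theorem _root_.Matrix.PosSemidef.apply_eq_zero_of_diag_eq_zero {ι : Type*} [Fintype ι]
    [DecidableEq ι] {M : Matrix ι ι ℝ} (hM : M.PosSemidef) {i j : ι} (h : M j j = 0) :
    M i j = 0 := by
  have hdet := (hM.submatrix ![i, j]).det_nonneg
  have hs : M j i = M i j := by simpa using hM.1.apply i j
  simp only [det_fin_two, submatrix_apply, cons_val_zero, cons_val_one, h, hs] at hdet
  nlinarith

section Lists

variable {α β : Type*}

theorem eq_map_inl_of_countP_isRight_eq_zero {l : List (α ⊕ β)} (h : l.countP Sum.isRight = 0) :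
    ∃ l' : List α, l = l'.map Sum.inl := by
  induction l with
  | nil => exact ⟨[], rfl⟩
  | cons c l ih =>
    cases c with
    | inl a =>
      obtain ⟨l', rfl⟩ := ih (by simpa using h)
      exact ⟨a :: l', rfl⟩
    | inr b => simp at h

theorem countP_isRight_map_inl (l : List α) :
    (l.map (Sum.inl : α → α ⊕ β)).countP Sum.isRight = 0 := by
  simp

/-- A word with a letter of the second kind splits at the first such letter. -/
theorem exists_eq_append_inr_cons {l : List (α ⊕ β)} (h : 0 < l.countP Sum.isRight) :
    ∃ (u : List α) (b : β) (w : List (α ⊕ β)), l = u.map Sum.inl ++ Sum.inr b :: w := by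
  induction l with
  | nil => simp at h
  | cons c l ih =>
    cases c with
    | inl a =>
      obtain ⟨u, b, w, rfl⟩ := ih (by simpa using h)
      exact ⟨a :: u, b, w, rfl⟩
    | inr b => exact ⟨[], b, l, rfl⟩

theorem map_inl_append_inr_cons_inj {u u' : List α} {b b' : β} {w w' : List (α ⊕ β)}
    (h : u.map Sum.inl ++ Sum.inr b :: w = u'.map Sum.inl ++ Sum.inr b' :: w') :
    u = u' ∧ b = b' ∧ w = w' := by
  induction u generalizing u' with
  | nil =>
    cases u' with
    | nil => simpa using h
    | cons a u' => simp at h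
  | cons a u ih =>
    cases u' with
    | nil => simp at h
    | cons a' u' =>
      simp only [List.map_cons, List.cons_append, List.cons.injEq, Sum.inl.injEq] at h
      obtain ⟨rfl, rfl, rfl⟩ := ih h.2
      exact ⟨by rw [h.1], rfl, rfl⟩

end Lists

variable {g : ℕ}

/-- A convex polynomial has degree at most two in `x`. Suppose that the degree is `D > 2` and write
a word of degree `D` in the form `u x_i m x_j w` with its first two letters from `x`. The diagonal
block of the middle matrix at the border monomial `x_j w` collects words of degree at least
`2 (D - 2) + 2 > D`, so it vanishes, and with it the column of this block. -/
theorem degXLE_two {W : NCSet₂ g} (hdom : W.IsDomain) (hopen : W.IsOpenSeq)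
    (hne : ∃ n : ℕ, 0 < n ∧ (W n).Nonempty) {p : PolyAX g} (hp : star p = p)
    (hconv : W.ConvexInX p) : DegXLE p 2 := by
  rw [degXLE_iff]
  by_contra! hcon
  obtain ⟨l₁, hl₁, hdeg₁⟩ := hcon
  obtain ⟨d, hd⟩ := exists_length_le p
  obtain ⟨l, hl, hmax⟩ := ((wordsLE (Fin g ⊕ Fin g) d).filter
    fun l => wcoeff p l ≠ 0).exists_max_image (List.countP Sum.isRight)
    ⟨l₁, by simpa [hl₁] using hd l₁ hl₁⟩
  simp only [Finset.mem_filter, mem_wordsLE, and_imp] at hl hmax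
  have hdeg : 2 < l.countP Sum.isRight := hdeg₁.trans_le (hmax l₁ (hd l₁ hl₁) hl₁)
  obtain ⟨u, i, l', rfl⟩ := exists_eq_append_inr_cons (l := l) (by omega)
  obtain ⟨m, j, w, rfl⟩ := exists_eq_append_inr_cons (l := l') (by
    simp only [List.countP_append, countP_isRight_map_inl, List.countP_cons] at hdeg
    simp at hdeg
    omega)
  obtain ⟨N, B, Y, v, hBY, hli⟩ := exists_linearIndependent_words hdom hopen hne d
  have hM := middleMatrix_posSemidef hdom hopen hne hp hconv hd hBY
  have hlen := hl.1
  simp only [List.length_append, List.length_map, List.length_cons] at hlen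
  have hdiag : middleBlock p d B Y (j, w) (j, w) = 0 := by
    refine Finset.sum_eq_zero fun m' _ => ?_
    rw [show wcoeff p (w.reverse ++ Sum.inr j :: (m' ++ Sum.inr j :: w)) = 0 from ?_, zero_smul]
    by_contra h0
    have := hmax _ (hd _ h0) h0
    simp only [List.countP_append, countP_isRight_map_inl, List.countP_cons, List.countP_reverse,
      Sum.isRight_inr, if_true] at this hdeg
    omega
  have hoff : middleBlock p d B Y (i, (u.map Sum.inl).reverse) (j, w) = 0 := by
    ext k k'
    refine hM.apply_eq_zero_of_diag_eq_zero
      (i := ((i, ⟨(u.map Sum.inl).reverse, ?_⟩), k)) (j := ((j, ⟨w, ?_⟩), k')) ?_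
    · simp only [mem_wordsLE, List.length_reverse, List.length_map]
      omega
    · simp only [mem_wordsLE]
      omega
    · exact congrFun (congrFun hdiag k') k'
  -- the vanishing block, applied to `v`, is a linear relation between the independent words, and
  -- the coefficient of the chosen word of degree `D` occurs in it
  have hsum := congrArg (· *ᵥ v) hoff
  simp only [middleBlock, List.reverse_reverse, sum_mulVec, smul_mulVec, zero_mulVec] at hsum
  rw [← Finset.sum_coe_sort] at hsum
  refine hl.2 (Fintype.linearIndependent_iff.1 hli (fun m : wordsLE (Fin g ⊕ Fin g) d =>
    wcoeff p (u.map Sum.inl ++ Sum.inr i :: (m.1 ++ Sum.inr j :: w))) hsum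
    ⟨m.map Sum.inl, ?_⟩)
  simp only [mem_wordsLE, List.length_map]
  omega

end NCPoly

/-! ### Convexity of polynomials of degree two -/

namespace NCPoly

variable {g : ℕ}

section Affine

variable {n : ℕ} (A X Y : SymTuple g n)

theorem prod_letters_eq {l : List (Fin g ⊕ Fin g)} (h : l.countP Sum.isRight = 0) :
    (l.map (letters A X)).prod = (l.map (letters A Y)).prod := by
  obtain ⟨l, rfl⟩ := eq_map_inl_of_countP_isRight_eq_zero h
  simp [Function.comp_def, letters]

theorem prod_letters_affine {l : List (Fin g ⊕ Fin g)} (h : l.countP Sum.isRight ≤ 1) (t : ℝ) :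
    (l.map (letters A (t • X + (1 - t) • Y))).prod =
      t • (l.map (letters A X)).prod + (1 - t) • (l.map (letters A Y)).prod := by
  induction l with
  | nil => simp only [List.map_nil, List.prod_nil]; module
  | cons c l ih =>
    cases c with
    | inl a =>
      simp only [List.map_cons, List.prod_cons, ih (by simpa using h), mul_add, mul_smul_comm]
      rfl
    | inr b =>
      have h0 : l.countP Sum.isRight = 0 := by
        simp only [List.countP_cons, Sum.isRight_inr, if_true] at h
        omega
      simp only [List.map_cons, List.prod_cons, prod_letters_eq A _ Y h0]
      rw [← smul_mul_assoc, ← smul_mul_assoc, ← add_mul]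
      rfl

theorem eval_affine {q : PolyAX g} (hq : DegXLE q 1) (t : ℝ) :
    eval A (t • X + (1 - t) • Y) q = t • eval A X q + (1 - t) • eval A Y q := by
  obtain ⟨d, hd⟩ := exists_length_le q
  simp only [eval_eq_sum A _ hd, Finset.smul_sum, ← Finset.sum_add_distrib]
  refine Finset.sum_congr rfl fun l _ => ?_
  by_cases h : wcoeff q l = 0
  · simp [h]
  · rw [prod_letters_affine A X Y (degXLE_iff.1 hq l h)]
    module

theorem eval_inclA (q : PolyA g) : eval A X (inclA q) = evalA A q := by
  have h : (FreeAlgebra.lift ℝ (letters A X)).comp inclA =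
      FreeAlgebra.lift ℝ (fun j => (A j : Matrix (Fin n) (Fin n) ℝ)) := by
    ext1
    ext1 j
    simp [inclA, letters]
  exact AlgHom.congr_fun h q

/-- The column `V(A, X)` of a column `V` of polynomials, as a block matrix. -/
noncomputable def evalCol {N : ℕ} (V : Fin N → PolyAX g) :
    Matrix (Fin N × Fin n) (Fin n) ℝ :=
  Matrix.of fun r k => eval A X (V r.1) r.2 k

theorem eval_quadForm {N : ℕ} (Z : Matrix (Fin N) (Fin N) (PolyA g)) (V : Fin N → PolyAX g) :
    eval A X (quadForm Z V) = (evalCol A X V)ᵀ * evalMatA Z A * evalCol A X V := by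
  have h : eval A X (quadForm Z V) =
      ∑ i, ∑ j, (eval A X (V i))ᵀ * evalA A (Z i j) * eval A X (V j) := by
    simp only [← eval_star, ← eval_inclA A X]
    simp only [eval, quadForm, map_sum, map_mul]
  rw [h]
  ext k k'
  simp only [Matrix.sum_apply, mul_apply, transpose_apply, evalCol, evalMatA, of_apply,
    Fintype.sum_prod_type, Finset.sum_mul]
  rw [Finset.sum_comm]
  refine Finset.sum_congr rfl fun j _ => ?_
  rw [Finset.sum_comm]

end Affine

/-- A polynomial `L + Vᵀ Z V` with `L` of degree at most one and `V` linear in `x` is convex in `x`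
over the set where `Z` is positive semidefinite: its convexity defect along a segment is
`t (1 - t) (V(X) - V(Y))ᵀ Z (V(X) - V(Y))`. -/
theorem convexInX_of_representation {U : NCSet g} {L : PolyAX g} {N : ℕ}
    {Z : Matrix (Fin N) (Fin N) (PolyA g)} {V : Fin N → PolyAX g} (hL : DegXLE L 1)
    (hV : ∀ i, LinearInX (V i))
    (hZ : ∀ (n : ℕ) (A : SymTuple g n), A ∈ U n → (evalMatA Z A).PosSemidef) :
    (NCSet₂.prod U (NCSet.full g)).ConvexInX (L + quadForm Z V) := by
  intro n A X Y hAX _ _ t ht0 ht1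
  have hcol : evalCol A (t • X + (1 - t) • Y) V =
      t • evalCol A X V + (1 - t) • evalCol A Y V := by
    ext r k
    have hVr : DegXLE (V r.1) 1 := fun w hw => (hV r.1 w hw).le
    simp only [evalCol, of_apply, eval_affine A X Y hVr, Matrix.add_apply,
      Matrix.smul_apply]
  have hadd : ∀ X : SymTuple g n, eval A X (L + quadForm Z V) =
      eval A X L + (evalCol A X V)ᵀ * evalMatA Z A * evalCol A X V := fun X => by
    rw [← eval_quadForm]
    exact map_add _ _ _
  have h := ((hZ n A hAX.1).conjTranspose_mul_mul_same (evalCol A X V - evalCol A Y V)).smul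
    (mul_nonneg ht0 (sub_nonneg.2 ht1))
  convert h using 1
  rw [hadd, hadd, hadd, eval_affine A X Y hL, hcol, conjTranspose_eq_transpose_of_trivial]
  simp only [transpose_add, transpose_sub, transpose_smul, Matrix.add_mul,
    Matrix.mul_add, Matrix.sub_mul, Matrix.mul_sub, Matrix.smul_mul, Matrix.mul_smul]
  module

/-! ### The representation -/

/-- The border monomials `x_i u` with `u` a word in `a` of length at most `d`, encoded as `(i, u)`. -/
abbrev Border (g d : ℕ) : Type := Fin g × wordsLE (Fin g) d

/-- The word `(x_i u)ᵀ m x_j w` for border monomials `x_i u` and `x_j w`. -/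
def quadWord {d : ℕ} (r s : Border g d) (m : List (Fin g)) : List (Fin g ⊕ Fin g) :=
  (r.2.1.map Sum.inl).reverse ++
    Sum.inr r.1 :: (m.map Sum.inl ++ Sum.inr s.1 :: s.2.1.map Sum.inl)

/-- An enumeration of the border monomials. -/
noncomputable def borderEquiv (g d : ℕ) : Fin (Fintype.card (Border g d)) ≃ Border g d :=
  (Fintype.equivFin _).symm

/-- The middle matrix of the part of `p` of degree two in `x`. -/
noncomputable def middlePoly (p : PolyAX g) (d : ℕ) :
    Matrix (Fin (Fintype.card (Border g d))) (Fin (Fintype.card (Border g d))) (PolyA g) :=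
  Matrix.of fun i j => ∑ m ∈ wordsLE (Fin g) d,
    wcoeff p (quadWord (borderEquiv g d i) (borderEquiv g d j) m) • word m

/-- The column of the border monomials. -/
noncomputable def borderCol (g d : ℕ) (i : Fin (Fintype.card (Border g d))) : PolyAX g :=
  word (Sum.inr (borderEquiv g d i).1 :: (borderEquiv g d i).2.1.map Sum.inl)

theorem linearInX_borderCol (d : ℕ) (i) : LinearInX (borderCol g d i) := by
  rw [linearInX_iff]
  intro l hl
  rw [borderCol, wcoeff_word, ite_ne_right_iff] at hl
  rw [← hl.1]
  simp only [List.countP_cons, countP_isRight_map_inl, Sum.isRight_inr, if_true]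

theorem countP_quadWord {d : ℕ} (r s : Border g d) (m : List (Fin g)) :
    (quadWord r s m).countP Sum.isRight = 2 := by
  simp only [quadWord, List.countP_append, List.countP_reverse, List.countP_cons,
    countP_isRight_map_inl, Sum.isRight_inr, if_true]

theorem quadWord_reverse {d : ℕ} (r s : Border g d) (m : List (Fin g)) :
    (quadWord r s m).reverse = quadWord s r m.reverse := by
  simp [quadWord]

theorem quadWord_injective {d : ℕ} {r r' s s' : Border g d} {m m' : List (Fin g)}
    (h : quadWord r s m = quadWord r' s' m') : r = r' ∧ s = s' ∧ m = m' := by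
  obtain ⟨i, u, hu⟩ := r
  obtain ⟨i', u', hu'⟩ := r'
  obtain ⟨j, w, hw⟩ := s
  obtain ⟨j', w', hw'⟩ := s'
  simp only [quadWord, ← List.map_reverse] at h
  obtain ⟨h1, rfl, h2⟩ := map_inl_append_inr_cons_inj h
  obtain ⟨rfl, rfl, h3⟩ := map_inl_append_inr_cons_inj h2
  obtain rfl := List.reverse_injective h1
  obtain rfl := List.map_injective_iff.2 Sum.inl_injective h3
  exact ⟨rfl, rfl, rfl⟩

theorem exists_quadWord {d : ℕ} {l : List (Fin g ⊕ Fin g)} (h : l.countP Sum.isRight = 2)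
    (hl : l.length ≤ d) :
    ∃ (r s : Border g d) (m : wordsLE (Fin g) d), quadWord r s m.1 = l := by
  obtain ⟨u, i, l', rfl⟩ := exists_eq_append_inr_cons (l := l) (by omega)
  simp only [List.countP_append, countP_isRight_map_inl, List.countP_cons, Sum.isRight_inr,
    if_true] at h
  obtain ⟨m, j, w, rfl⟩ := exists_eq_append_inr_cons (l := l') (by omega)
  simp only [List.countP_append, countP_isRight_map_inl, List.countP_cons, Sum.isRight_inr,
    if_true] at h
  obtain ⟨w, rfl⟩ := eq_map_inl_of_countP_isRight_eq_zero (l := w) (by omega)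
  simp only [List.length_append, List.length_map, List.length_cons] at hl
  exact ⟨(i, ⟨u.reverse, by simp only [mem_wordsLE, List.length_reverse]; omega⟩),
    (j, ⟨w, by simp only [mem_wordsLE]; omega⟩), ⟨m, by simp only [mem_wordsLE]; omega⟩,
    by simp [quadWord]⟩

theorem inclA_word (m : List (Fin g)) : inclA (word m) = word (m.map Sum.inl) := by
  rw [inclA, lift_word, word, List.map_map]
  rfl

theorem quadForm_eq_sum (p : PolyAX g) (d : ℕ) :
    quadForm (middlePoly p d) (borderCol g d) =
      ∑ r : Border g d, ∑ s : Border g d, ∑ m : wordsLE (Fin g) d,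
        wcoeff p (quadWord r s m.1) • word (quadWord r s m.1) := by
  rw [quadForm, ← (borderEquiv g d).sum_comp]
  refine Finset.sum_congr rfl fun i _ => ?_
  rw [← (borderEquiv g d).sum_comp]
  refine Finset.sum_congr rfl fun j _ => ?_
  rw [Finset.sum_coe_sort (wordsLE (Fin g) d) fun m =>
    wcoeff p (quadWord (borderEquiv g d i) (borderEquiv g d j) m) •
      word (quadWord (borderEquiv g d i) (borderEquiv g d j) m)]
  simp only [middlePoly, of_apply, map_sum, map_smul, Finset.mul_sum, Finset.sum_mul,
    mul_smul_comm, smul_mul_assoc, borderCol, star_word, inclA_word, ← word_append]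
  refine Finset.sum_congr rfl fun m _ => ?_
  simp [quadWord]

/-- The quadratic form of the middle matrix is the part of `p` of degree two in `x`. -/
theorem wcoeff_quadForm {p : PolyAX g} {d : ℕ} (hd : ∀ l, wcoeff p l ≠ 0 → l.length ≤ d)
    (l : List (Fin g ⊕ Fin g)) :
    wcoeff (quadForm (middlePoly p d) (borderCol g d)) l =
      if l.countP Sum.isRight = 2 then wcoeff p l else 0 := by
  simp only [quadForm_eq_sum, wcoeff_sum, wcoeff_smul, wcoeff_word, mul_ite, mul_one, mul_zero]
  by_cases h : ∃ (r s : Border g d) (m : wordsLE (Fin g) d), quadWord r s m.1 = l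
  · obtain ⟨r, s, m, rfl⟩ := h
    rw [if_pos (countP_quadWord r s m.1), Finset.sum_eq_single r, Finset.sum_eq_single s,
      Finset.sum_eq_single m, if_pos rfl]
    · exact fun m' _ hm => if_neg fun h => hm (Subtype.ext (quadWord_injective h).2.2)
    · simp
    · exact fun s' _ hs => Finset.sum_eq_zero fun m' _ =>
        if_neg fun h => hs (quadWord_injective h).2.1
    · simp
    · exact fun r' _ hr => Finset.sum_eq_zero fun s' _ => Finset.sum_eq_zero fun m' _ =>
        if_neg fun h => hr (quadWord_injective h).1
    · simp
  · push Not at h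
    simp only [h, if_false, Finset.sum_const_zero]
    split_ifs with h2
    · by_contra h0
      obtain ⟨r, s, m, hm⟩ := exists_quadWord h2 (hd l (Ne.symm h0))
      exact h r s m hm
    · rfl

theorem star_middlePoly {p : PolyAX g} (hp : star p = p) (d : ℕ) (i j) :
    star (middlePoly p d i j) = middlePoly p d j i := by
  simp only [middlePoly, of_apply, star_sum, star_smul_word]
  rw [← sum_wordsLE_reverse]
  refine Finset.sum_congr rfl fun m _ => ?_
  rw [List.reverse_reverse]
  congr 1
  conv_lhs => rw [← hp, wcoeff_star, quadWord_reverse, List.reverse_reverse]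

theorem evalA_word {n : ℕ} (A X : SymTuple g n) (m : List (Fin g)) :
    evalA A (word m) = ((m.map Sum.inl).map (letters A X)).prod := by
  rw [evalA, lift_word, List.map_map]
  rfl

theorem evalA_middlePoly {p : PolyAX g} (hp2 : DegXLE p 2) {n : ℕ} (d : ℕ) (A X : SymTuple g n)
    (i j) :
    evalA A (middlePoly p d i j) = middleBlock p d A X
      ((borderEquiv g d i).1, (borderEquiv g d i).2.1.map Sum.inl)
      ((borderEquiv g d j).1, (borderEquiv g d j).2.1.map Sum.inl) := by
  have h1 : evalA A (middlePoly p d i j) = ∑ m ∈ wordsLE (Fin g) d,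
      wcoeff p (quadWord (borderEquiv g d i) (borderEquiv g d j) m) •
        ((m.map Sum.inl).map (letters A X)).prod := by
    simp only [← evalA_word, middlePoly, of_apply, evalA, map_sum, map_smul]
  rw [h1, middleBlock]
  refine Finset.sum_of_injOn (List.map Sum.inl)
    (List.map_injective_iff.2 Sum.inl_injective).injOn (fun m hm => ?_) (fun m hm hm' => ?_)
    fun m _ => rfl
  · simpa using hm
  · rw [show wcoeff p _ = 0 from ?_, zero_smul]
    by_contra h0
    have h2 := degXLE_iff.1 hp2 _ h0
    simp only [List.countP_append, List.countP_cons, Sum.isRight_inr, if_true] at h2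
    obtain ⟨m', rfl⟩ := eq_map_inl_of_countP_isRight_eq_zero (l := m) (by omega)
    exact hm' ⟨m', by simpa using hm, rfl⟩

theorem evalMatA_middlePoly_posSemidef {W : NCSet₂ g} (hdom : W.IsDomain) (hopen : W.IsOpenSeq)
    (hne : ∃ n : ℕ, 0 < n ∧ (W n).Nonempty) {p : PolyAX g} (hp : star p = p)
    (hconv : W.ConvexInX p) {d : ℕ} (hd : ∀ l, wcoeff p l ≠ 0 → l.length ≤ d) {n : ℕ}
    {A : SymTuple g n} (hA : A ∈ W.projA n) : (evalMatA (middlePoly p d) A).PosSemidef := by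
  obtain ⟨X, hAX⟩ := hA
  have h := (middleMatrix_posSemidef hdom hopen hne hp hconv hd hAX).submatrix
    fun r : Fin (Fintype.card (Border g d)) × Fin n =>
      (((borderEquiv g d r.1).1, ⟨(borderEquiv g d r.1).2.1.map Sum.inl, by
        simpa only [mem_wordsLE, List.length_map] using (borderEquiv g d r.1).2.2⟩), r.2)
  convert h using 1
  ext r s
  simp only [evalMatA, of_apply, submatrix_apply, middleMatrix,
    evalA_middlePoly (degXLE_two hdom hopen hne hp hconv) d A X]

end NCPoly

theorem mainTheorem2 (g : ℕ) (hg : 0 < g) (W : NCSet₂ g) (hdom : W.IsDomain)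
    (hopen : W.IsOpenSeq) (hne : ∃ n : ℕ, 0 < n ∧ (W n).Nonempty)
    (p : PolyAX g) (hp : star p = p) (hconv : W.ConvexInX p) :
    (∃ (L : PolyAX g) (N : ℕ) (Z : Matrix (Fin N) (Fin N) (PolyA g)) (V : Fin N → PolyAX g),
      p = L + NCPoly.quadForm Z V ∧
      (∀ i j, star (Z i j) = Z j i) ∧
      (∀ (n : ℕ) (A : SymTuple g n), A ∈ W.projA n → (NCPoly.evalMatA Z A).PosSemidef) ∧
      (∀ i, NCPoly.LinearInX (V i)) ∧
      star L = L ∧ NCPoly.DegXLE L 1) ∧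
    (NCSet₂.prod W.projA (NCSet.full g)).ConvexInX p ∧
    NCPoly.DegXLE p 2 := by
  open NCPoly in
  obtain ⟨d, hd⟩ := exists_length_le p
  have hdeg : DegXLE p 2 := degXLE_two hdom hopen hne hp hconv
  set Q := quadForm (middlePoly p d) (borderCol g d) with hQ
  have hpQ : p = p - Q + Q := (sub_add_cancel p Q).symm
  have hZ : ∀ (n : ℕ) (A : SymTuple g n), A ∈ W.projA n →
      (evalMatA (middlePoly p d) A).PosSemidef := fun n A hA =>
    evalMatA_middlePoly_posSemidef hdom hopen hne hp hconv hd hA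
  have hL : DegXLE (p - Q) 1 := by
    rw [degXLE_iff]
    intro l hl
    rw [wcoeff_sub, hQ, wcoeff_quadForm hd] at hl
    split_ifs at hl with h2
    · simp at hl
    · have := degXLE_iff.1 hdeg l (by simpa using hl)
      omega
  have hstar : star Q = Q := by
    refine ext_wcoeff fun l => ?_
    rw [wcoeff_star, hQ, wcoeff_quadForm hd, wcoeff_quadForm hd, List.countP_reverse,
      ← wcoeff_star, hp]
  refine ⟨⟨p - Q, _, middlePoly p d, borderCol g d, hpQ, star_middlePoly hp d, hZ,
    linearInX_borderCol d, by rw [star_sub, hp, hstar], hL⟩, ?_, hdeg⟩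
  rw [hpQ, hQ]
  rw [hQ] at hL
  exact convexInX_of_representation hL (linearInX_borderCol d) hZ
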